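/- Let $S$ be a compact Borel space (a compact metrizable space), let $A$ and $\mathcal Z$ be Borel spaces (Borel subsets of Polish spaces), let $N\ge 1$ and $\beta\in(0,1)$. For every $x\in S$ let $D(x)\subset A$ be given, put $D=\{(x,a)\in S\times A: a\in D(x)\}$, and suppose that there is a measurable $f:S\to A$ with $f(x)\in D(x)$ for all $x$. Let $\mathbb P(S)$ be the set of probability measures on $S$ with the weak topology, let $T:S\times A\times\mathbb P(S)\times\mathcal Z^2\to S$ be measurable and let $r:S\times A\times\mathbb P(S)\to\mathbb R$ be bounded. Let $Z_n^i$ ($n\ge 1$, $1\le i\le N$) and $Z_n^0$ ($n\ge 1$) be independent $\mathcal Z$-valued random variables such that all $Z^i_n$, $1\le i\le N$, have the same law and all $Z^0_n$ have the same law; write $\mathbf Z_n=(Z_n^1,\dots,Z_n^N)$, and let $(\mathbf Z,Z^0)$ be a copy of $(\mathbf Z_1,Z_1^0)$. For a tuple $\mathbf y=(y_1,\dots,y_N)$ let $\mu[\mathbf y]=\frac1N\sum_{i=1}^N\delta_{y_i}$. Let $\mathbb P_N(S)=\{\mu[\mathbf x]:\mathbf x\in S^N\}$, with the weak topology, let $\mathbb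 P_N(D)$ be the set of all $\mu[(\mathbf x,\mathbf a)]=\frac1N\sum_{i}\delta_{(x_i,a_i)}$ with $(x_i,a_i)\in D$ for all $i$, and for $\mu\in\mathbb P_N(S)$ let $$\hat D(\mu)=\{\mu[(\mathbf x,\mathbf a)] : \mathbf x\in S^N,\ \mu[\mathbf x]=\mu,\ a_i\in D(x_i)\text{ for all } i\}.$$ For $Q\in\hat D(\mu)$ put $\hat r(\mu,Q)=\int_D r(x,a,\mu)\,Q(d(x,a))$ and $$\hat T(\mu,Q,\mathbf z,z^0)=\mu\big[(T(x_i,a_i,\mu,z_i,z^0))_{i=1,\dots,N}\big],\qquad Q=\mu[(\mathbf x,\mathbf a)],$$ where the atoms $(x_i,a_i)$ of $Q$, repeated according to multiplicity, are listed in an order that depends measurably on $Q$ and is fixed once and for all (the law of $\hat T(\mu,Q,\mathbf Z,Z^0)$ does not depend on it). Let $\hat F$ be the set of measurable $\varphi:\mathbb P_N(S)\to\mathbb P_N(D)$ with $\varphi(\mu)\in\hat D(\mu)$ for all $\mu$. A policy is a sequence $\psi=(\varphi_0,\varphi_1,\dots)$ in $\hat F$. Started in $\mu_0=\mu$ it yields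 $\mu_{n+1}=\hat T(\mu_n,\varphi_n(\mu_n),\mathbf Z_{n+1},Z^0_{n+1})$, and $$J^N_\psi(\mu)=\sum_{k=0}^\infty\beta^k\,\mathbb E\big[\hat r(\mu_k,\varphi_k(\mu_k))\big],\qquad J^N(\mu)=\sup_\psi J^N_\psi(\mu).$$ Let $\hat{\mathbb M}$ be the set of bounded upper semicontinuous $v:\mathbb P_N(S)\to\mathbb R$, and let $$(\hat Uv)(\mu)=\sup_{Q\in\hat D(\mu)}\big\{\hat r(\mu,Q)+\beta\,\mathbb E\,v(\hat T(\mu,Q,\mathbf Z,Z^0))\big\}.$$ A decision rule $\varphi\in\hat F$ is a maximizer of $v$ if for every $\mu\in\mathbb P_N(S)$ the supremum in $(\hat Uv)(\mu)$ is attained at $Q=\varphi(\mu)$. Assume: (A0) $D$ is compact. (A1) If $x_n\to x$ in $S$ and $a_n\in D(x_n)$ for all $n$, then $(a_n)$ has an accumulation point in $D(x)$. (A2) $(x,a,\mu)\mapsto r(x,a,\mu)$ is upper semicontinuous. (A3) $(x,a,\mu)\mapsto T(x,a,\mu,z,z_0)$ is continuous for all $z,z_0\in\mathcal Z$. Then $\hat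 U$ maps $\hat{\mathbb M}$ into itself, and: a) $J^N\in\hat{\mathbb M}$, and $J^N$ is the unique fixed point of $\hat U$ in $\hat{\mathbb M}$; in particular $J^N=\hat UJ^N$. b) $J^N=\lim_{n\to\infty}\hat U^n0$, uniformly on $\mathbb P_N(S)$. c) There is a maximizer $\varphi^*\in\hat F$ of $J^N$, and every maximizer $\varphi^*\in\hat F$ of $J^N$ defines an optimal stationary policy: $J^N_{(\varphi^*,\varphi^*,\dots)}(\mu)=J^N(\mu)$ for all $\mu\in\mathbb P_N(S)$. -/

import Mathlib

open MeasureTheory ProbabilityTheory Filter Topology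
open scoped ENNReal

namespace MeanField

section Empirical

variable {X : Type*} [MeasurableSpace X] {N : ℕ}

/-- The empirical measure `μ[x] = (1/N) ∑ i, δ_{x i}` of `N ≥ 1` points. -/
noncomputable def empirical [NeZero N] (x : Fin N → X) : ProbabilityMeasure X :=
  ⟨(N : ℝ≥0∞)⁻¹ • ∑ i, Measure.dirac (x i), ⟨by
    have h : (N : ℝ≥0∞) ≠ 0 := by exact_mod_cast NeZero.ne N
    simp [ENNReal.inv_mul_cancel h (ENNReal.natCast_ne_top N)]⟩⟩

/-- The set `ℙ_N(X)` of all empirical measures of `N` points of `X`, as a subspace of the space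
of probability measures (weak topology, and the `σ`-algebra generated by the evaluations). -/
abbrev EmpMeas (N : ℕ) [NeZero N] (X : Type*) [MeasurableSpace X] : Type _ :=
  {μ : ProbabilityMeasure X // ∃ x : Fin N → X, μ = empirical x}

/-- The empirical measure of a tuple, as a point of `ℙ_N(X)`. -/
noncomputable def emp [NeZero N] (x : Fin N → X) : EmpMeas N X := ⟨empirical x, x, rfl⟩

theorem empirical_perm [NeZero N] (x : Fin N → X) (σ : Equiv.Perm (Fin N)) :
    empirical (x ∘ σ) = empirical x := by
  apply Subtype.ext
  change (N : ℝ≥0∞)⁻¹ • ∑ i, Measure.dirac (x (σ i)) = (N : ℝ≥0∞)⁻¹ • ∑ i, Measure.dirac (x i)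
  rw [Equiv.sum_comp σ (fun i => Measure.dirac (x i))]

theorem empirical_apply [NeZero N] (x : Fin N → X) {s : Set X} (hs : MeasurableSet s) :
    ((empirical x : ProbabilityMeasure X) : Measure X) s
      = (N : ℝ≥0∞)⁻¹ * ∑ i, s.indicator 1 (x i) := by
  change ((N : ℝ≥0∞)⁻¹ • ∑ i, Measure.dirac (x i)) s = _
  simp [Measure.dirac_apply' _ hs]

/-- Two increasing tuples of reals with the same distribution function agree. -/
theorem eq_of_monotone_of_count {u w : Fin N → ℝ} (hu : Monotone u) (hw : Monotone w)
    (h : ∀ q : ℚ, (Finset.univ.filter fun i => u i ≤ q).card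
      = (Finset.univ.filter fun i => w i ≤ q).card) : u = w := by
  have key : ∀ {u w : Fin N → ℝ}, Monotone u → Monotone w →
      (∀ q : ℚ, (Finset.univ.filter fun i => u i ≤ q).card
        = (Finset.univ.filter fun i => w i ≤ q).card) → ∀ k, ¬ u k < w k := by
    intro u w hu hw h k hk
    obtain ⟨q, hq1, hq2⟩ := exists_rat_btwn hk
    have h1 : (Finset.Iic k) ⊆ Finset.univ.filter fun i => u i ≤ q := by
      intro i hi
      simp only [Finset.mem_Iic] at hi
      simpa using (hu hi).trans hq1.le
    have h2 : (Finset.univ.filter fun i => w i ≤ q) ⊆ Finset.Iio k := by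
      intro i hi
      simp only [Finset.mem_filter, Finset.mem_univ, true_and] at hi
      simp only [Finset.mem_Iio]
      by_contra hc
      exact absurd (hw (not_lt.mp hc)) (not_le.mpr (lt_of_le_of_lt hi hq2))
    have c1 := Finset.card_le_card h1
    have c2 := Finset.card_le_card h2
    rw [Fin.card_Iic] at c1
    rw [Fin.card_Iio] at c2
    have := h q
    omega
  funext k
  exact le_antisymm (not_lt.mp (key hw hu (fun q => (h q).symm) k)) (not_lt.mp (key hu hw h k))

/-- The atoms of an empirical measure can be listed in a measurable way. -/
theorem exists_measurable_enum [StandardBorelSpace X] [NeZero N] :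
    ∃ e : EmpMeas N X → (Fin N → X), Measurable e ∧ ∀ Q, emp (e Q) = Q := by
  classical
  set ι := embeddingReal X with hι
  have hιe : MeasurableEmbedding ι := measurableEmbedding_embeddingReal X
  let C : Set (Fin N → X) := {x | Monotone (ι ∘ x)}
  have hC : MeasurableSet C := by
    have : C = ⋂ i, ⋂ j, {x : Fin N → X | i ≤ j → ι (x i) ≤ ι (x j)} := by
      ext x
      simp only [C, Set.mem_ofPred_eq, Set.mem_iInter]
      exact ⟨fun h i j hij => h hij, fun h i j hij => h i j hij⟩
    rw [this]
    refine MeasurableSet.iInter fun i => MeasurableSet.iInter fun j => ?_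
    by_cases hij : i ≤ j
    · simp only [hij, true_imp_iff]
      exact measurableSet_le (hιe.measurable.comp (measurable_pi_apply i))
        (hιe.measurable.comp (measurable_pi_apply j))
    · simp [hij]
  let B : ℚ → Set X := fun q => ι ⁻¹' Set.Iic (q : ℝ)
  have hB : ∀ q, MeasurableSet (B q) := fun q => hιe.measurable measurableSet_Iic
  let F : EmpMeas N X → (ℚ → ℝ≥0∞) := fun Q q => ((Q : ProbabilityMeasure X) : Measure X) (B q)
  have hF : Measurable F := by
    refine measurable_pi_lambda _ fun q => ?_
    exact (Measure.measurable_coe (hB q)).comp (measurable_subtype_coe.comp measurable_subtype_coe)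
  let g : C → (ℚ → ℝ≥0∞) := fun x => F (emp (x : Fin N → X))
  have hgval : ∀ (x : Fin N → X) (q : ℚ), F (emp x) q
      = (N : ℝ≥0∞)⁻¹ * ((Finset.univ.filter fun i => (ι ∘ x) i ≤ q).card : ℝ≥0∞) := by
    intro x q
    change ((empirical x : ProbabilityMeasure X) : Measure X) (B q) = _
    rw [empirical_apply x (hB q), Finset.card_filter]
    push_cast
    congr 1
  have hg : Measurable g := by
    refine measurable_pi_lambda _ fun q => ?_
    have : (fun x : C => g x q)
        = fun x : C => (N : ℝ≥0∞)⁻¹ * ∑ i, (B q).indicator 1 ((x : Fin N → X) i) := by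
      funext x
      exact empirical_apply _ (hB q)
    rw [this]
    refine Measurable.const_mul (Finset.measurable_sum _ fun i _ => ?_) _
    exact (measurable_one.indicator (hB q)).comp
      ((measurable_pi_apply i).comp measurable_subtype_coe)
  have hginj : Function.Injective g := by
    rintro ⟨x, hx⟩ ⟨y, hy⟩ hxy
    have hN : (N : ℝ≥0∞)⁻¹ ≠ 0 := by simp
    have hN' : (N : ℝ≥0∞)⁻¹ ≠ ⊤ := by simpa using NeZero.ne N
    have : ι ∘ x = ι ∘ y := by
      refine eq_of_monotone_of_count hx hy fun q => ?_
      have h := congrFun hxy q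
      simp only [g] at h
      rw [hgval, hgval] at h
      exact_mod_cast (ENNReal.mul_right_inj hN hN').mp h
    exact Subtype.ext (hιe.injective.comp_left this)
  have : StandardBorelSpace C := hC.standardBorel
  have hge : MeasurableEmbedding g := hg.measurableEmbedding hginj
  rcases isEmpty_or_nonempty (EmpMeas N X) with hE | ⟨⟨_, x₀, _⟩⟩
  · exact ⟨fun Q => isEmptyElim Q, measurable_of_empty _, fun Q => isEmptyElim Q⟩
  · have sorted : ∀ x : Fin N → X, ∃ y : C, emp (y : Fin N → X) = emp x := fun x =>
      ⟨⟨x ∘ Tuple.sort (ι ∘ x), Tuple.monotone_sort (ι ∘ x)⟩,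
        Subtype.ext (empirical_perm x _)⟩
    have : Nonempty C := ⟨(sorted x₀).choose⟩
    refine ⟨fun Q => (hge.invFun (F Q) : C), ?_, ?_⟩
    · exact measurable_subtype_coe.comp (hge.measurable_invFun.comp hF)
    · rintro ⟨_, x, rfl⟩
      obtain ⟨y, hy⟩ := sorted x
      have h1 : F ⟨empirical x, x, rfl⟩ = g y := by
        change F (emp x) = F (emp (y : Fin N → X))
        rw [hy]
      beta_reduce
      rw [h1, hge.leftInverse_invFun y]
      exact hy

/-- A fixed measurable enumeration of the `N` atoms (with multiplicity) of an empirical measure. -/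
noncomputable def enum [StandardBorelSpace X] [NeZero N] : EmpMeas N X → (Fin N → X) :=
  (exists_measurable_enum (X := X) (N := N)).choose

theorem measurable_enum [StandardBorelSpace X] [NeZero N] :
    Measurable (enum : EmpMeas N X → (Fin N → X)) :=
  (exists_measurable_enum (X := X) (N := N)).choose_spec.1

theorem emp_enum [StandardBorelSpace X] [NeZero N] (Q : EmpMeas N X) : emp (enum Q) = Q :=
  (exists_measurable_enum (X := X) (N := N)).choose_spec.2 Q

end Empirical

/-- The data of the control problem of one individual: state space `S`, action space `A`,
disturbance space `𝒵`, admissible actions `D x`, transition function `T`, bounded reward `r`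
and discount factor `β`. -/
structure Model (S A 𝒵 : Type*) [TopologicalSpace S] [MeasurableSpace S]
    [MeasurableSpace A] [MeasurableSpace 𝒵] where
  D : S → Set A
  exists_selector : ∃ f : S → A, Measurable f ∧ ∀ x, f x ∈ D x
  T : S → A → ProbabilityMeasure S → 𝒵 → 𝒵 → S
  measurable_T : Measurable fun p : S × A × ProbabilityMeasure S × 𝒵 × 𝒵 =>
    T p.1 p.2.1 p.2.2.1 p.2.2.2.1 p.2.2.2.2
  r : S → A → ProbabilityMeasure S → ℝ
  bounded_r : ∃ C : ℝ, ∀ x a μ, |r x a μ| ≤ C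
  β : ℝ
  β_pos : 0 < β
  β_lt_one : β < 1

/-- The disturbances on a probability space `(Ω, P)`: `idio n i` is the idiosyncratic noise of
individual `i`, and `common n` the common noise, in the transition from time `n` to time `n + 1`.
All of them are independent, the idiosyncratic noises have one common law, and so do the common
noises. -/
structure Noise (N : ℕ) (𝒵 : Type*) [MeasurableSpace 𝒵] {Ω : Type*} [MeasurableSpace Ω]
    (P : Measure Ω) where
  idio : ℕ → Fin N → Ω → 𝒵
  common : ℕ → Ω → 𝒵
  measurable_idio : ∀ n i, Measurable (idio n i)
  measurable_common : ∀ n, Measurable (common n)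
  indep : iIndepFun (fun k : ℕ × Option (Fin N) => k.2.elim (common k.1) (idio k.1)) P
  ident_idio : ∀ n i m j, IdentDistrib (idio n i) (idio m j) P P
  ident_common : ∀ n m, IdentDistrib (common n) (common m) P P

namespace Model

section Assumptions

variable {S A 𝒵 : Type*} [TopologicalSpace S] [MeasurableSpace S]
  [TopologicalSpace A] [MeasurableSpace A] [MeasurableSpace 𝒵]

/-- The set `D = {(x, a) | a ∈ D x}`. -/
def graph (M : Model S A 𝒵) : Set (S × A) := {p | p.2 ∈ M.D p.1}

/-- `D` is compact. -/
def A0 (M : Model S A 𝒵) : Prop := IsCompact M.graph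

/-- `x ↦ D x` is upper semicontinuous. -/
def A1 (M : Model S A 𝒵) : Prop :=
  ∀ (x : S) (xs : ℕ → S) (as : ℕ → A), Tendsto xs atTop (𝓝 x) → (∀ n, as n ∈ M.D (xs n)) →
    ∃ a ∈ M.D x, MapClusterPt a atTop as

/-- The reward is upper semicontinuous in `(x, a, μ)`. -/
def A2 [OpensMeasurableSpace S] (M : Model S A 𝒵) : Prop :=
  UpperSemicontinuous fun p : S × A × ProbabilityMeasure S => M.r p.1 p.2.1 p.2.2

/-- The transition function is continuous in `(x, a, μ)` for all values of the noises. -/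
def A3 [OpensMeasurableSpace S] (M : Model S A 𝒵) : Prop :=
  ∀ z z₀ : 𝒵, Continuous fun p : S × A × ProbabilityMeasure S => M.T p.1 p.2.1 p.2.2 z z₀

end Assumptions

section MeanFieldMDP

variable {S A 𝒵 Ω : Type*} [TopologicalSpace S] [MeasurableSpace S]
  [MeasurableSpace A] [MeasurableSpace 𝒵] [MeasurableSpace Ω] {N : ℕ} [NeZero N]

/-- The set `D̂(μ)` of admissible actions: the empirical measures of `((x₁, a₁), …, (x_N, a_N))`
with `μ[x] = μ` and `a i ∈ D (x i)`. Measures on `D` are regarded as measures on `S × A`. -/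
def Dhat (M : Model S A 𝒵) (μ : EmpMeas N S) : Set (EmpMeas N (S × A)) :=
  {Q | ∃ (x : Fin N → S) (a : Fin N → A), emp x = μ ∧ (∀ i, a i ∈ M.D (x i)) ∧
    Q = emp fun i => (x i, a i)}

/-- The one-stage reward `r̂(μ, Q) = ∫_D r(x, a, μ) Q(d(x, a))`. -/
noncomputable def rhat (M : Model S A 𝒵) (μ : EmpMeas N S) (Q : EmpMeas N (S × A)) : ℝ :=
  ∫ p in M.graph, M.r p.1 p.2 μ.1 ∂(Q.1 : Measure (S × A))

/-- The transition function `T̂(μ, Q, z, z₀) = μ[(T(x i, a i, μ, z i, z₀))_i]`, where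
`Q = μ[(x, a)]`. Since `Q` does not determine the order of the pairs `(x i, a i)`, the latter are
listed by the measurable enumeration `enum`; as the noises of the individuals are exchangeable,
the law of the next state does not depend on the enumeration. -/
noncomputable def That [StandardBorelSpace S] [StandardBorelSpace A] (M : Model S A 𝒵)
    (μ : EmpMeas N S) (Q : EmpMeas N (S × A)) (z : Fin N → 𝒵) (z₀ : 𝒵) : EmpMeas N S :=
  emp fun i => M.T (enum Q i).1 (enum Q i).2 μ.1 (z i) z₀

variable (N) in
/-- The set `F̂` of decision rules: measurable maps `φ` with `φ μ ∈ D̂(μ)` for all `μ`. -/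
abbrev DecisionRule (M : Model S A 𝒵) : Type _ :=
  {φ : EmpMeas N S → EmpMeas N (S × A) // Measurable φ ∧ ∀ μ, φ μ ∈ M.Dhat μ}

variable [StandardBorelSpace S] [StandardBorelSpace A] {P : Measure Ω}

/-- The state process `μ₀ = μ`, `μ_{n+1} = T̂(μ_n, φ_n(μ_n), Z_{n+1}, Z⁰_{n+1})` under the policy
`ψ = (φ₀, φ₁, …)`. -/
noncomputable def state (M : Model S A 𝒵) (W : Noise N 𝒵 P) (ψ : ℕ → M.DecisionRule N)
    (μ : EmpMeas N S) : ℕ → Ω → EmpMeas N S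
  | 0, _ => μ
  | n + 1, ω => M.That (state M W ψ μ n ω) ((ψ n).1 (state M W ψ μ n ω))
      (fun i => W.idio n i ω) (W.common n ω)

/-- The expected discounted reward `∑ β^k 𝔼[r̂(μ_k, φ_k(μ_k))]` of a policy, started in `μ`. -/
noncomputable def policyValue (M : Model S A 𝒵) (W : Noise N 𝒵 P) (ψ : ℕ → M.DecisionRule N)
    (μ : EmpMeas N S) : ℝ :=
  ∑' k : ℕ, M.β ^ k *
    ∫ ω, M.rhat (M.state W ψ μ k ω) ((ψ k).1 (M.state W ψ μ k ω)) ∂P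

/-- The value function `J^N`, the supremum over all policies. -/
noncomputable def valueFn (M : Model S A 𝒵) (W : Noise N 𝒵 P) (μ : EmpMeas N S) : ℝ :=
  ⨆ ψ : ℕ → M.DecisionRule N, M.policyValue W ψ μ

/-- The expression `r̂(μ, Q) + β 𝔼 v(T̂(μ, Q, Z, Z⁰))`; the noise of the first transition serves
as the generic copy `(Z, Z⁰)`. -/
noncomputable def actionValue (M : Model S A 𝒵) (W : Noise N 𝒵 P) (v : EmpMeas N S → ℝ)
    (μ : EmpMeas N S) (Q : EmpMeas N (S × A)) : ℝ :=
  M.rhat μ Q + M.β * ∫ ω, v (M.That μ Q (fun i => W.idio 0 i ω) (W.common 0 ω)) ∂P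

/-- The operator `Û`. -/
noncomputable def Uhat (M : Model S A 𝒵) (W : Noise N 𝒵 P) (v : EmpMeas N S → ℝ) :
    EmpMeas N S → ℝ :=
  fun μ => ⨆ Q : M.Dhat μ, M.actionValue W v μ Q.1

/-- `φ` is a maximizer of `v`. -/
def IsMaximizer (M : Model S A 𝒵) (W : Noise N 𝒵 P) (v : EmpMeas N S → ℝ)
    (φ : M.DecisionRule N) : Prop :=
  ∀ μ, M.Uhat W v μ = M.actionValue W v μ (φ.1 μ)

end MeanFieldMDP

end Model

/-- The set `𝕄̂` of bounded upper semicontinuous functions on `ℙ_N(S)`. -/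
def Mhat (N : ℕ) [NeZero N] (S : Type*) [TopologicalSpace S] [MeasurableSpace S]
    [OpensMeasurableSpace S] : Set (EmpMeas N S → ℝ) :=
  {v | (∃ C : ℝ, ∀ μ, |v μ| ≤ C) ∧ UpperSemicontinuous v}

end MeanField

/-! Everything is lifted from measures to configurations, that is, tuples of `N` points of the graph
`D`. These form a compact metrizable space `configs`. The map `stateLaw` sends it continuously onto
`ℙ_N(S)`, and the fibre over `μ` is mapped by `emp` onto `D̂(μ)`. The enumeration used by `That`
permutes the configuration, but the noise is exchangeable, so the action value of `emp k` is a
function `configValue` of `k` alone (`actionValue_emp`). Reverse Fatou makes it upper semicontinuous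
whenever `v` is.

Hence `Û v` is the maximum of an upper semicontinuous function over the fibres of a continuous
surjection from a compact space. Its superlevel sets are images of compact sets, so `Û v` is again
upper semicontinuous. A selection argument chooses the maximizing configuration measurably, which
gives a maximizer in `F̂`.

Since `Û` is a `β`-contraction in the supremum norm, value iteration converges uniformly to a fixed
point in `𝕄̂`. Any fixed point `v` in `𝕄̂` is the value function: the state at time `n` is
independent of the next noise, so the Bellman inequality can be integrated along the state process
and telescoped. This bounds every policy by `v`, with equality for a maximizer of `v`. Regularity of
`J^N` and uniqueness both follow from this identification. -/

namespace MeanField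

/-! ### Measurable selection, fibrewise maxima, reverse Fatou -/

section Selection

/-- A closed-valued map into a compact space all of whose closed lower inverses are measurable
has a measurable selector. -/
theorem exists_measurable_selector {K Y : Type*} [TopologicalSpace K] [CompactSpace K] [T1Space K]
    [SecondCountableTopology K] [MeasurableSpace K] [BorelSpace K] [MeasurableSpace Y]
    {Ψ : Y → Set K} (hne : ∀ y, (Ψ y).Nonempty) (hcl : ∀ y, IsClosed (Ψ y))
    (hm : ∀ F : Set K, IsClosed F → MeasurableSet {y | (Ψ y ∩ F).Nonempty}) :
    ∃ s : Y → K, Measurable s ∧ ∀ y, s y ∈ Ψ y := by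
  classical
  -- Complements of a countable basis: countably many closed sets separating points.
  obtain ⟨F, hFcl, hFsep⟩ : ∃ F : ℕ → Set K, (∀ n, IsClosed (F n)) ∧
      ∀ x y, x ≠ y → ∃ n, x ∈ F n ∧ y ∉ F n := by
    obtain ⟨b, hbc, -, hb⟩ := TopologicalSpace.exists_countable_basis K
    rcases b.eq_empty_or_nonempty with rfl | hbne
    · refine ⟨fun _ => ∅, fun _ => isClosed_empty, fun x => ?_⟩
      have := hb.sUnion_eq
      simp only [Set.sUnion_empty] at this
      exact absurd (Set.mem_univ x) (this ▸ Set.notMem_empty x)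
    · obtain ⟨U, rfl⟩ := hbc.exists_eq_range hbne
      refine ⟨fun n => (U n)ᶜ, fun n => (hb.isOpen ⟨n, rfl⟩).isClosed_compl, fun x y hxy => ?_⟩
      obtain ⟨_, ⟨n, rfl⟩, hyn, hn⟩ := hb.exists_subset_of_mem_open
        (show y ∈ ({x}ᶜ : Set K) from hxy.symm) isOpen_compl_singleton
      exact ⟨n, fun h => hn h rfl, fun h => h hyn⟩
  -- Stage `n` cuts the current set down to `F n` whenever something remains. By compactness the
  -- limit is nonempty, and since the `F n` separate points it is a singleton: the selected value.
  let Φ : ℕ → Y → Set K := fun n => Nat.rec Ψ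
    (fun n Θ y => if (Θ y ∩ F n).Nonempty then Θ y ∩ F n else Θ y) n
  have hΦ : ∀ n y, Φ (n + 1) y = if (Φ n y ∩ F n).Nonempty then Φ n y ∩ F n else Φ n y :=
    fun _ _ => rfl
  have hΦne : ∀ n y, (Φ n y).Nonempty := by
    intro n y
    induction n with
    | zero => exact hne y
    | succ n ih =>
      rw [hΦ]
      split_ifs with h
      exacts [h, ih]
  have hΦcl : ∀ n y, IsClosed (Φ n y) := by
    intro n y
    induction n with
    | zero => exact hcl y
    | succ n ih =>
      rw [hΦ]
      split_ifs with h
      exacts [ih.inter (hFcl n), ih]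
  have hΦanti : ∀ n y, Φ (n + 1) y ⊆ Φ n y := by
    intro n y
    rw [hΦ]
    split_ifs
    exacts [Set.inter_subset_left, subset_rfl]
  have hΦm : ∀ n, ∀ G : Set K, IsClosed G → MeasurableSet {y | (Φ n y ∩ G).Nonempty} := by
    intro n
    induction n with
    | zero => exact hm
    | succ n ih =>
      intro G hG
      -- Splitting by whether the cut is made reduces the claim to stage `n` with the closed sets `F
      -- n`, `F n ∩ G` and `G`.
      have : {y | (Φ (n + 1) y ∩ G).Nonempty} =
          ({y | (Φ n y ∩ F n).Nonempty} ∩ {y | (Φ n y ∩ (F n ∩ G)).Nonempty}) ∪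
          ({y | (Φ n y ∩ F n).Nonempty}ᶜ ∩ {y | (Φ n y ∩ G).Nonempty}) := by
        ext y
        simp only [Set.mem_ofPred_eq, Set.mem_union, Set.mem_inter_iff, Set.mem_compl_iff]
        rw [hΦ]
        split_ifs with h <;> simp [h, Set.inter_assoc]
      rw [this]
      exact ((ih _ (hFcl n)).inter (ih _ ((hFcl n).inter hG))).union
        ((ih _ (hFcl n)).compl.inter (ih _ hG))
  have hcap : ∀ y, (⋂ n, Φ n y).Nonempty := fun y =>
    IsCompact.nonempty_iInter_of_sequence_nonempty_isCompact_isClosed _ (fun n => hΦanti n y)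
      (fun n => hΦne n y) (hΦcl 0 y).isCompact (fun n => hΦcl n y)
  choose s hs using hcap
  have huniq : ∀ y k, k ∈ ⋂ n, Φ n y → k = s y := by
    intro y k hk
    by_contra hne
    obtain ⟨n, h1, h2⟩ := hFsep _ _ hne
    have hk' := Set.mem_iInter.mp hk
    have hs' := Set.mem_iInter.mp (hs y) (n + 1)
    rw [hΦ, if_pos ⟨k, hk' n, h1⟩] at hs'
    exact h2 hs'.2
  refine ⟨s, measurable_of_isClosed fun G hG => ?_, fun y => Set.mem_iInter.mp (hs y) 0⟩
  -- If every stage meets `G`, compactness gives a point of `G` in all stages, and by uniqueness it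
  -- is `s y`.
  have : s ⁻¹' G = ⋂ n, {y | (Φ n y ∩ G).Nonempty} := by
    ext y
    simp only [Set.mem_preimage, Set.mem_iInter, Set.mem_ofPred_eq]
    refine ⟨fun h n => ⟨s y, Set.mem_iInter.mp (hs y) n, h⟩, fun h => ?_⟩
    obtain ⟨k, hk⟩ := IsCompact.nonempty_iInter_of_sequence_nonempty_isCompact_isClosed
      (fun n => Φ n y ∩ G) (fun n => Set.inter_subset_inter_left _ (hΦanti n y)) h
      ((hΦcl 0 y).inter hG).isCompact (fun n => (hΦcl n y).inter hG)
    rw [Set.mem_iInter] at hk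
    rw [← huniq y k (Set.mem_iInter.mpr fun n => (hk n).1)]
    exact (hk 0).2
  rw [this]
  exact MeasurableSet.iInter fun n => hΦm n G hG

variable {K Y : Type*} [TopologicalSpace K] [CompactSpace K] [TopologicalSpace Y] [T2Space Y]
  {p : K → Y} {g : K → ℝ}

theorem exists_isGreatest_fiber (hp : Continuous p) (hps : Function.Surjective p)
    (hg : UpperSemicontinuous g) (y : Y) : ∃ k, p k = y ∧ ∀ k', p k' = y → g k' ≤ g k := by
  obtain ⟨k, hk, hmax⟩ := UpperSemicontinuousOn.exists_isMaxOn (s := p ⁻¹' {y}) (f := g) (hps y)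
    (isClosed_singleton.preimage hp).isCompact (hg.upperSemicontinuousOn _)
  exact ⟨k, hk, fun k' hk' => hmax hk'⟩

/-- Continuous images of compact sets are closed in a Hausdorff space. The image consists of the `y`
whose fibre meets `F` at level at least `c`; both semicontinuity and measurability of the fibrewise
maximum rest on it. -/
theorem isClosed_image_inter_Ici (hp : Continuous p) (hg : UpperSemicontinuous g) {F : Set K}
    (hF : IsClosed F) (c : ℝ) : IsClosed (p '' (F ∩ g ⁻¹' Set.Ici c)) :=
  ((hF.inter (hg.isClosed_preimage c)).isCompact.image hp).isClosed

/-- The fibrewise maximum of an upper semicontinuous function is upper semicontinuous. -/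
theorem upperSemicontinuous_of_isGreatest_fiber (hp : Continuous p) (hg : UpperSemicontinuous g)
    {v : Y → ℝ} (hv : ∀ y, IsGreatest (g '' (p ⁻¹' {y})) (v y)) : UpperSemicontinuous v := by
  rw [upperSemicontinuous_iff_isClosed_preimage]
  intro c
  convert isClosed_image_inter_Ici hp hg isClosed_univ c using 1
  ext y
  simp only [Set.mem_preimage, Set.mem_Ici, Set.univ_inter, Set.mem_image]
  constructor
  · intro h
    obtain ⟨k, hk, hkv⟩ := (hv y).1
    exact ⟨k, hkv ▸ h, hk⟩
  · rintro ⟨k, hk, rfl⟩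
    exact le_trans hk ((hv (p k)).2 ⟨k, rfl, rfl⟩)

/-- An upper semicontinuous function on a compact space can be maximized over the fibres of a
continuous surjection in a measurable way. -/
theorem exists_measurable_argmax_fiber [T1Space K] [SecondCountableTopology K] [MeasurableSpace K]
    [BorelSpace K] [MeasurableSpace Y] [OpensMeasurableSpace Y]
    (hp : Continuous p) (hps : Function.Surjective p) (hg : UpperSemicontinuous g) :
    ∃ s : Y → K, Measurable s ∧ ∀ y, p (s y) = y ∧ ∀ k, p k = y → g k ≤ g (s y) := by
  choose m hm hmax using exists_isGreatest_fiber hp hps hg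
  have hv : UpperSemicontinuous fun y => g (m y) :=
    upperSemicontinuous_of_isGreatest_fiber hp hg fun y =>
      ⟨⟨m y, hm y, rfl⟩, by rintro _ ⟨k, hk, rfl⟩; exact hmax y k hk⟩
  have hmeas : ∀ F : Set K, IsClosed F →
      MeasurableSet {y | (p ⁻¹' {y} ∩ g ⁻¹' Set.Ici (g (m y)) ∩ F).Nonempty} := by
    intro F hF
    -- The argmax set meets `F` iff, for every rational `q` up to the maximum, `F` contains a fibre
    -- point of level at least `q`. For the converse, `g` attains its maximum on `F` within the
    -- fibre, and this dominates all rationals below `g (m y)`.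
    have : {y | (p ⁻¹' {y} ∩ g ⁻¹' Set.Ici (g (m y)) ∩ F).Nonempty} =
        ⋂ q : ℚ, ({y | g (m y) < q} ∪ p '' (F ∩ g ⁻¹' Set.Ici (q : ℝ))) := by
      ext y
      simp only [Set.mem_ofPred_eq, Set.mem_iInter, Set.mem_union]
      constructor
      · rintro ⟨k, ⟨hk1, hk2⟩, hk3⟩ q
        refine or_iff_not_imp_left.mpr fun hq => ⟨k, ⟨hk3, (not_lt.mp hq).trans hk2⟩, hk1⟩
      · intro h
        obtain ⟨q₀, hq₀⟩ := exists_rat_lt (g (m y))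
        have key : ∀ q : ℚ, (q : ℝ) < g (m y) → ∃ k ∈ F ∩ p ⁻¹' {y}, (q : ℝ) ≤ g k := by
          intro q hq
          obtain ⟨k, ⟨h1, h2⟩, h3⟩ := (h q).resolve_left (not_lt.mpr hq.le)
          exact ⟨k, ⟨h1, h3⟩, h2⟩
        obtain ⟨k₀, hk₀, -⟩ := key q₀ hq₀
        obtain ⟨k, hk, hkm⟩ := UpperSemicontinuousOn.exists_isMaxOn (f := g) ⟨k₀, hk₀⟩
          (hF.inter (isClosed_singleton.preimage hp)).isCompact (hg.upperSemicontinuousOn _)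
        refine ⟨k, ⟨hk.2, ?_⟩, hk.1⟩
        refine le_of_forall_rat_lt_imp_le (K := ℝ) fun q hq => ?_
        obtain ⟨k', hk', hq'⟩ := key q hq
        exact hq'.trans (hkm hk')
    rw [this]
    exact MeasurableSet.iInter fun q => (measurableSet_lt hv.measurable measurable_const).union
      (isClosed_image_inter_Ici hp hg hF q).measurableSet
  obtain ⟨s, hs, hsm⟩ := exists_measurable_selector
    (Ψ := fun y => p ⁻¹' {y} ∩ g ⁻¹' Set.Ici (g (m y)))
    (fun y => ⟨m y, hm y, le_refl (g (m y))⟩)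
    (fun y => (isClosed_singleton.preimage hp).inter (hg.isClosed_preimage _)) hmeas
  exact ⟨s, hs, fun y => ⟨(hsm y).1, fun k hk => (hmax y k hk).trans (hsm y).2⟩⟩

end Selection

/-- Reverse Fatou: integrating a parameter of a bounded upper semicontinuous integrand. -/
theorem upperSemicontinuous_integral {K Ω : Type*} [TopologicalSpace K]
    [FirstCountableTopology K] [MeasurableSpace Ω] {P : Measure Ω} [IsProbabilityMeasure P]
    {f : K → Ω → ℝ} {C : ℝ} (hm : ∀ k, Measurable (f k)) (hC : ∀ k ω, |f k ω| ≤ C)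
    (hf : ∀ ω, UpperSemicontinuous fun k => f k ω) :
    UpperSemicontinuous fun k => ∫ ω, f k ω ∂P := by
  have hint : ∀ k, Integrable (f k) P := fun k =>
    Integrable.of_bound (hm k).aestronglyMeasurable C (ae_of_all _ (hC k))
  have hval : ∀ k, ∫⁻ ω, ENNReal.ofReal (C - f k ω) ∂P = ENNReal.ofReal (C - ∫ ω, f k ω ∂P) := by
    intro k
    have h := ofReal_integral_eq_lintegral_ofReal (μ := P) (f := fun ω => C - f k ω)
      ((integrable_const C).sub (hint k))
      (ae_of_all _ fun ω => sub_nonneg.mpr (le_of_abs_le (hC k ω)))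
    rw [← h, integral_sub (integrable_const C) (hint k)]
    simp
  intro k c hc
  by_contra hcon
  obtain ⟨ks, hks, hks'⟩ := exists_seq_forall_of_frequently (not_eventually.mp hcon)
  -- Upper semicontinuity makes the nonnegative functions `C - f` lower semicontinuous along the
  -- sequence, so Fatou's lemma applies to them.
  have h1 : ∫⁻ ω, ENNReal.ofReal (C - f k ω) ∂P ≤
      ∫⁻ ω, liminf (fun n => ENNReal.ofReal (C - f (ks n) ω)) atTop ∂P := by
    refine lintegral_mono fun ω => le_of_forall_lt fun b hb => ?_
    obtain ⟨b', hb1, hb2⟩ := exists_between hb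
    refine hb1.trans_le (le_liminf_of_le (by isBoundedDefault) ?_)
    have hfin : b' ≠ ⊤ := ne_top_of_lt hb2
    have h3 : f k ω < C - b'.toReal := by
      have := (ENNReal.lt_ofReal_iff_toReal_lt hfin).mp hb2
      linarith
    filter_upwards [hks.eventually (hf ω k _ h3)] with n hn
    rw [ENNReal.le_ofReal_iff_toReal_le hfin
      (sub_nonneg.mpr (le_of_abs_le (hC _ ω)))]
    linarith
  have h2 := h1.trans (lintegral_liminf_le fun n => ((hm (ks n)).const_sub C).ennreal_ofReal)
  have h3 : liminf (fun n => ∫⁻ ω, ENNReal.ofReal (C - f (ks n) ω) ∂P) atTop ≤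
      ENNReal.ofReal (C - c) := by
    refine liminf_le_of_frequently_le' (Frequently.of_forall fun n => ?_)
    rw [hval]
    exact ENNReal.ofReal_le_ofReal (by linarith [not_lt.mp (hks' n)])
  have h4 := h2.trans h3
  rw [hval] at h4
  -- For `C ≤ c`, `ENNReal.ofReal` truncates to `0` and the bound yields only `C ≤ ∫ f k`; the
  -- contradiction then comes from `∫ f (ks 0) ≤ C`.
  rcases le_or_gt (C - c) 0 with hcc | hcc
  · have : ∫ ω, f (ks 0) ω ∂P ≤ C := by
      calc _ ≤ ∫ _, C ∂P := integral_mono (hint _) (integrable_const C)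
              fun ω => le_of_abs_le (hC _ ω)
        _ = C := by simp
    rw [ENNReal.ofReal_of_nonpos hcc, nonpos_iff_eq_zero, ENNReal.ofReal_eq_zero] at h4
    linarith [not_lt.mp (hks' 0)]
  · have := (ENNReal.ofReal_le_ofReal_iff hcc.le).mp h4
    linarith

end MeanField

namespace MeanField

/-! ### Topology, measurability and symmetry of empirical measures -/

section EmpiricalProperties

variable {X : Type*} [MeasurableSpace X] {N : ℕ} [NeZero N]

theorem emp_perm (x : Fin N → X) (σ : Equiv.Perm (Fin N)) : emp (x ∘ σ) = emp x :=
  Subtype.ext (empirical_perm x σ)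

theorem measurable_emp : Measurable (emp : (Fin N → X) → EmpMeas N X) := by
  refine Measurable.subtype_mk (Measurable.subtype_mk (Measure.measurable_of_measurable_coe _ ?_))
  intro s hs
  have : (fun x : Fin N → X => ((N : ℝ≥0∞)⁻¹ • ∑ i, Measure.dirac (x i)) s)
      = fun x : Fin N → X => (N : ℝ≥0∞)⁻¹ * ∑ i, s.indicator 1 (x i) := by
    funext x
    exact empirical_apply x hs
  rw [this]
  refine Measurable.const_mul (Finset.measurable_sum _ fun i _ => ?_) _
  exact (measurable_one.indicator hs).comp (measurable_pi_apply i)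

theorem integral_empirical [MeasurableSingletonClass X] (x : Fin N → X) (f : X → ℝ) :
    ∫ y, f y ∂(empirical x : Measure X) = (N : ℝ)⁻¹ * ∑ i, f (x i) := by
  change ∫ y, f y ∂((N : ℝ≥0∞)⁻¹ • ∑ i, Measure.dirac (x i)) = _
  rw [integral_smul_measure, integral_finsetSum_measure fun i _ => by
    exact integrable_dirac (by simp)]
  simp

theorem continuous_emp [TopologicalSpace X] [OpensMeasurableSpace X]
    [MeasurableSingletonClass X] : Continuous (emp : (Fin N → X) → EmpMeas N X) := by
  refine Continuous.subtype_mk (continuous_iff_continuousAt.mpr fun x => ?_) _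
  rw [ContinuousAt, ProbabilityMeasure.tendsto_iff_forall_integral_tendsto]
  intro f
  simp only [integral_empirical]
  have : Continuous fun y : Fin N → X => (N : ℝ)⁻¹ * ∑ i, f (y i) := by fun_prop
  exact this.tendsto x

theorem emp_surjective : Function.Surjective (emp : (Fin N → X) → EmpMeas N X) := by
  rintro ⟨_, x, rfl⟩
  exact ⟨x, rfl⟩

/-- Borel sets of the weak topology belong to the `σ`-algebra generated by the evaluations. -/
instance opensMeasurableSpace_empMeas [TopologicalSpace X] [PolishSpace X] [BorelSpace X] :
    OpensMeasurableSpace (EmpMeas N X) := by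
  refine ⟨borel_eq_generateFrom_isClosed.trans_le (MeasurableSpace.generateFrom_le ?_)⟩
  intro C hC
  -- As `enum` is a measurable section of `emp`, measurability of `C` is tested on tuples, where
  -- closed sets are measurable.
  have : C = enum ⁻¹' (emp ⁻¹' C) := by
    ext Q
    simp [emp_enum]
  rw [this]
  exact measurable_enum (hC.preimage continuous_emp).measurableSet

/-- Tuples with the same empirical measure are permutations of each other. -/
theorem exists_perm_of_emp_eq [MeasurableSingletonClass X] {x y : Fin N → X}
    (h : emp x = emp y) : ∃ σ : Equiv.Perm (Fin N), y ∘ σ = x := by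
  classical
  have hcard : ∀ p, Fintype.card {i // x i = p} = Fintype.card {i // y i = p} := by
    intro p
    have hN : (N : ℝ) ≠ 0 := by exact_mod_cast NeZero.ne N
    -- Integrating the indicator of `{p}` counts the indices with value `p`.
    have h1 := congrArg
      (fun Q : EmpMeas N X => ∫ a, (if a = p then (1 : ℝ) else 0) ∂(Q.1 : Measure X)) h
    simp only [emp, integral_empirical] at h1
    have h2 := mul_left_cancel₀ (inv_ne_zero hN) h1
    simp only [Finset.sum_boole] at h2
    rw [Fintype.card_subtype, Fintype.card_subtype]
    exact_mod_cast h2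
  -- The permutation is glued from bijections between the index sets of equal value.
  let σ := (Equiv.sigmaFiberEquiv x).symm.trans
    ((Equiv.sigmaCongrRight fun p => Fintype.equivOfCardEq (hcard p)).trans
      (Equiv.sigmaFiberEquiv y))
  refine ⟨σ, funext fun i => ?_⟩
  exact (Fintype.equivOfCardEq (hcard (x i)) ⟨i, rfl⟩).2

theorem exists_perm_enum_emp [StandardBorelSpace X] (x : Fin N → X) :
    ∃ σ : Equiv.Perm (Fin N), x ∘ σ = enum (emp x) :=
  exists_perm_of_emp_eq (emp_enum _)

end EmpiricalProperties

/-! ### Independence and exchangeability of the noise -/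

namespace Noise

variable {𝒵 Ω : Type*} [MeasurableSpace 𝒵] [MeasurableSpace Ω] {N : ℕ} {P : Measure Ω}

/-- The noise of one transition, as a single random vector. -/
def vec (W : Noise N 𝒵 P) (n : ℕ) (ω : Ω) : Option (Fin N) → 𝒵 :=
  fun j => j.elim (W.common n ω) (fun i => W.idio n i ω)

/-- The common law of the noises of all transitions. -/
noncomputable def law (W : Noise N 𝒵 P) : Measure (Option (Fin N) → 𝒵) := P.map (W.vec 0)

theorem measurable_elim (W : Noise N 𝒵 P) (k : ℕ × Option (Fin N)) :
    Measurable (k.2.elim (W.common k.1) (W.idio k.1)) := by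
  obtain ⟨n, _ | i⟩ := k
  exacts [W.measurable_common n, W.measurable_idio n i]

theorem vec_eq (W : Noise N 𝒵 P) (n : ℕ) :
    W.vec n = fun ω j => (j.elim (W.common n) (W.idio n) : Ω → 𝒵) ω := by
  funext ω j
  cases j <;> rfl

theorem measurable_vec (W : Noise N 𝒵 P) (n : ℕ) : Measurable (W.vec n) := by
  rw [vec_eq]
  exact measurable_pi_lambda _ fun j => W.measurable_elim (n, j)

/-- The information generated by the noises of the first `n` transitions. -/
@[reducible]
def past (W : Noise N 𝒵 P) (n : ℕ) : MeasurableSpace Ω :=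
  ⨆ k ∈ {k : ℕ × Option (Fin N) | k.1 < n},
    MeasurableSpace.comap (k.2.elim (W.common k.1) (W.idio k.1)) inferInstance

theorem past_mono (W : Noise N 𝒵 P) : Monotone W.past := fun _ _ hmn =>
  biSup_mono fun _ hk => lt_of_lt_of_le hk hmn

theorem past_le (W : Noise N 𝒵 P) (n : ℕ) : W.past n ≤ ‹MeasurableSpace Ω› :=
  iSup₂_le fun k _ => (W.measurable_elim k).comap_le

theorem measurable_vec_past (W : Noise N 𝒵 P) (n : ℕ) : Measurable[W.past (n + 1)] (W.vec n) := by
  rw [vec_eq]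
  refine @measurable_pi_lambda _ _ _ (W.past (n + 1)) _ _ fun j => ?_
  refine Measurable.of_comap_le ?_
  exact le_iSup₂_of_le (n, j) (Nat.lt_succ_self n) le_rfl

/-- The index sets `k.1 < n` and `k.1 = n` are disjoint, so they generate independent `σ`-algebras.
-/
theorem indepFun_vec_of_past (W : Noise N 𝒵 P) {E : Type*} [MeasurableSpace E] {n : ℕ} {X : Ω → E}
    (hX : Measurable[W.past n] X) : IndepFun X (W.vec n) P := by
  rw [IndepFun_iff_Indep]
  have hdisj : Disjoint {k : ℕ × Option (Fin N) | k.1 < n} {k | k.1 = n} := by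
    rw [Set.disjoint_left]
    intro k hk hk'
    exact absurd hk' (Nat.ne_of_lt hk)
  have h := indep_iSup_of_disjoint (fun k => (W.measurable_elim k).comap_le) W.indep hdisj
  refine indep_of_indep_of_le_left (indep_of_indep_of_le_right h ?_) hX.comap_le
  rw [vec_eq]
  refine Measurable.comap_le (@measurable_pi_lambda _ _ _ (_) _ _ fun j => ?_)
  exact Measurable.of_comap_le (le_iSup₂_of_le (n, j) (rfl : n = n) le_rfl)

variable [IsProbabilityMeasure P]

instance (W : Noise N 𝒵 P) : IsProbabilityMeasure W.law :=
  Measure.isProbabilityMeasure_map (W.measurable_vec 0).aemeasurable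

/-- The law of the noise does not depend on the transition nor on the order of the individuals. -/
theorem map_vec_perm (W : Noise N 𝒵 P) (n : ℕ) (σ : Equiv.Perm (Fin N)) :
    P.map (fun ω j => W.vec n ω (Option.map σ j)) = W.law := by
  -- By independence the law is the product of its marginals, and these depend neither on `n` nor on
  -- `σ`.
  have h : ∀ (n : ℕ) (σ : Equiv.Perm (Fin N)), P.map (fun ω j => W.vec n ω (Option.map σ j))
      = Measure.pi fun j : Option (Fin N) => P.map (j.elim (W.common 0) (W.idio 0)) := by
    intro n σ
    have hi : iIndepFun (fun j : Option (Fin N) =>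
        ((Option.map σ j).elim (W.common n) (W.idio n) : Ω → 𝒵)) P :=
      W.indep.precomp (g := fun j => (n, Option.map σ j)) fun a b hab =>
        Option.map_injective σ.injective (Prod.ext_iff.mp hab).2
    have hpi := (iIndepFun_iff_map_fun_eq_pi_map
      fun j => (W.measurable_elim (n, Option.map σ j)).aemeasurable).mp hi
    simp only [vec_eq]
    rw [hpi]
    congr 1
    funext j
    cases j with
    | none => exact (W.ident_common n 0).map_eq
    | some i => exact (W.ident_idio n (σ i) 0 i).map_eq
  rw [h n σ, ← h 0 (Equiv.refl _)]
  simp [law]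

theorem integral_vec_perm (W : Noise N 𝒵 P) (n : ℕ) (σ : Equiv.Perm (Fin N))
    {F : (Option (Fin N) → 𝒵) → ℝ} (hF : Measurable F) :
    ∫ ω, F (fun j => W.vec n ω (Option.map σ j)) ∂P = ∫ z, F z ∂W.law := by
  rw [← W.map_vec_perm n σ, integral_map _ hF.aestronglyMeasurable]
  exact (measurable_pi_lambda _ fun j =>
    (measurable_pi_apply _).comp (W.measurable_vec n)).aemeasurable

theorem integral_vec (W : Noise N 𝒵 P) (n : ℕ)
    {F : (Option (Fin N) → 𝒵) → ℝ} (hF : Measurable F) :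
    ∫ ω, F (W.vec n ω) ∂P = ∫ z, F z ∂W.law := by
  simpa using W.integral_vec_perm n (Equiv.refl _) hF

/-- The noise of a transition can be integrated out before what happened earlier. -/
theorem integral_past_vec (W : Noise N 𝒵 P) {E : Type*} [MeasurableSpace E] {n : ℕ} {X : Ω → E}
    (hX : Measurable[W.past n] X) {F : E → (Option (Fin N) → 𝒵) → ℝ}
    (hF : Measurable (Function.uncurry F)) {C : ℝ} (hC : ∀ x z, |F x z| ≤ C) :
    ∫ ω, F (X ω) (W.vec n ω) ∂P = ∫ ω, ∫ z, F (X ω) z ∂W.law ∂P := by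
  have hXm : Measurable X := hX.mono (W.past_le n) le_rfl
  have hmap := (indepFun_iff_map_prod_eq_prod_map_map hXm.aemeasurable
    (W.measurable_vec n).aemeasurable).mp (W.indepFun_vec_of_past hX)
  have hlaw : P.map (W.vec n) = W.law := by simpa using W.map_vec_perm n (Equiv.refl _)
  rw [hlaw] at hmap
  have := Measure.isProbabilityMeasure_map (μ := P) hXm.aemeasurable
  have h1 : ∫ ω, F (X ω) (W.vec n ω) ∂P
      = ∫ q, Function.uncurry F q ∂(P.map X).prod W.law := by
    rw [← hmap, integral_map (hXm.prodMk (W.measurable_vec n)).aemeasurable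
      hF.aestronglyMeasurable]
    rfl
  rw [h1, integral_prod _ (Integrable.of_bound hF.aestronglyMeasurable C
    (ae_of_all _ fun q => hC q.1 q.2)), integral_map hXm.aemeasurable]
  · rfl
  · exact hF.stronglyMeasurable.integral_prod_right'.aestronglyMeasurable

end Noise

end MeanField

namespace MeanField

/-! ### Configurations, action values and the operator `Û` -/

namespace Model

set_option linter.unusedSectionVars false

variable {S A 𝒵 Ω : Type*}
  [TopologicalSpace S] [PolishSpace S] [MeasurableSpace S] [BorelSpace S]
  [TopologicalSpace A] [TopologicalSpace.MetrizableSpace A] [SecondCountableTopology A]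
  [MeasurableSpace A] [BorelSpace A]
  [MeasurableSpace 𝒵] [MeasurableSpace Ω] {P : Measure Ω} {N : ℕ} [NeZero N]

variable (N) in
/-- The admissible configurations of the `N` individuals: tuples of points of `D`. -/
def configs (M : Model S A 𝒵) : Set (Fin N → S × A) := {k | ∀ i, k i ∈ M.graph}

/-- The empirical measure of the states of a configuration. -/
noncomputable def stateLaw (k : Fin N → S × A) : EmpMeas N S := emp fun i => (k i).1

theorem continuous_stateLaw : Continuous (stateLaw : (Fin N → S × A) → EmpMeas N S) :=
  continuous_emp.comp (by fun_prop)

theorem isCompact_configs {M : Model S A 𝒵} (h0 : M.A0) : IsCompact (M.configs N) := by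
  have : M.configs N = Set.univ.pi fun _ => M.graph := by
    ext k
    simp [configs]
  rw [this]
  exact isCompact_univ_pi fun _ => h0

theorem measurableSet_graph {M : Model S A 𝒵} (h0 : M.A0) : MeasurableSet M.graph :=
  h0.isClosed.measurableSet

theorem mem_Dhat_iff {M : Model S A 𝒵} {μ : EmpMeas N S} {Q : EmpMeas N (S × A)} :
    Q ∈ M.Dhat μ ↔ ∃ k ∈ M.configs N, stateLaw k = μ ∧ emp k = Q := by
  constructor
  · rintro ⟨x, a, hx, ha, rfl⟩
    exact ⟨fun i => (x i, a i), ha, hx, rfl⟩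
  · rintro ⟨k, hk, hx, rfl⟩
    exact ⟨fun i => (k i).1, fun i => (k i).2, hx, hk, rfl⟩

/-- Makes the fibres of `stateLaw` nonempty, hence also every `D̂(μ)`. -/
theorem exists_configs_stateLaw (M : Model S A 𝒵) (μ : EmpMeas N S) :
    ∃ k ∈ M.configs N, stateLaw k = μ := by
  obtain ⟨f, -, hf⟩ := M.exists_selector
  obtain ⟨x, rfl⟩ := emp_surjective μ
  exact ⟨fun i => (x i, f (x i)), fun i => hf (x i), rfl⟩

/-- The next state of the population, given the configuration and the noise. -/
noncomputable def step (M : Model S A 𝒵) (μ : EmpMeas N S) (k : Fin N → S × A)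
    (z : Option (Fin N) → 𝒵) : EmpMeas N S :=
  emp fun i => M.T (k i).1 (k i).2 μ.1 (z (some i)) (z none)

theorem measurable_step (M : Model S A 𝒵) :
    Measurable fun q : EmpMeas N S × (Fin N → S × A) × (Option (Fin N) → 𝒵) =>
      M.step q.1 q.2.1 q.2.2 := by
  refine measurable_emp.comp (measurable_pi_lambda _ fun i => ?_)
  have h : Measurable fun q : EmpMeas N S × (Fin N → S × A) × (Option (Fin N) → 𝒵) =>
      ((q.2.1 i).1, (q.2.1 i).2, q.1.1, q.2.2 (some i), q.2.2 none) := by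
    fun_prop
  exact M.measurable_T.comp h

theorem measurable_step_right (M : Model S A 𝒵) (μ : EmpMeas N S) (k : Fin N → S × A) :
    Measurable (M.step μ k) := by
  have h : Measurable fun z : Option (Fin N) → 𝒵 => (μ, k, z) :=
    measurable_const.prodMk (measurable_const.prodMk measurable_id)
  have h' := M.measurable_step.comp h
  exact h'

theorem continuous_step {M : Model S A 𝒵} (h3 : M.A3) (z : Option (Fin N) → 𝒵) :
    Continuous fun k : Fin N → S × A => M.step (stateLaw k) k z := by
  refine continuous_emp.comp (continuous_pi fun i => ?_)
  have hs := continuous_subtype_val.comp (continuous_stateLaw (S := S) (A := A) (N := N))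
  have hc : Continuous fun k : Fin N → S × A => ((k i).1, (k i).2, (stateLaw k).1) :=
    (by fun_prop : Continuous fun k : Fin N → S × A => (k i).1).prodMk
      ((by fun_prop : Continuous fun k : Fin N → S × A => (k i).2).prodMk hs)
  exact (h3 (z (some i)) (z none)).comp hc

/-- Relabelling the individuals amounts to relabelling their noises inversely, because `emp` forgets
the order. -/
theorem step_perm (M : Model S A 𝒵) (μ : EmpMeas N S) (k : Fin N → S × A)
    (z : Option (Fin N) → 𝒵) (σ : Equiv.Perm (Fin N)) :
    M.step μ (k ∘ σ) z = M.step μ k fun j => z (Option.map σ.symm j) := by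
  unfold step
  rw [← emp_perm (fun i => M.T (k i).1 (k i).2 μ.1 _ _) σ]
  simp [Function.comp_def]

theorem rhat_emp {M : Model S A 𝒵} (h0 : M.A0) (μ : EmpMeas N S) {k : Fin N → S × A}
    (hk : k ∈ M.configs N) :
    M.rhat μ (emp k) = (N : ℝ)⁻¹ * ∑ i, M.r (k i).1 (k i).2 μ.1 := by
  unfold rhat
  rw [← integral_indicator (measurableSet_graph h0)]
  change ∫ q, _ ∂(empirical k : Measure (S × A)) = _
  rw [integral_empirical]
  congr 1
  exact Finset.sum_congr rfl fun i _ => Set.indicator_of_mem (hk i) _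

theorem abs_rhat_emp_le {M : Model S A 𝒵} (h0 : M.A0) {R : ℝ} (hR : ∀ x a μ, |M.r x a μ| ≤ R)
    (μ : EmpMeas N S) {k : Fin N → S × A} (hk : k ∈ M.configs N) : |M.rhat μ (emp k)| ≤ R := by
  have hN : (0 : ℝ) < N := by exact_mod_cast NeZero.pos N
  rw [rhat_emp h0 μ hk, abs_mul, abs_of_pos (inv_pos.mpr hN), inv_mul_le_iff₀ hN]
  calc |∑ i, M.r (k i).1 (k i).2 μ.1| ≤ ∑ i : Fin N, R :=
        (Finset.abs_sum_le_sum_abs _ _).trans (Finset.sum_le_sum fun i _ => hR _ _ _)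
    _ = N * R := by simp

/-- Replacing `μ` by a tuple of atoms keeps semicontinuity, `emp` being continuous, and on the tuple
space it also yields the measurability needed in `measurable_rhat_rule`. -/
theorem upperSemicontinuous_r {M : Model S A 𝒵} (h2 : M.A2) :
    UpperSemicontinuous fun q : (S × A) × (Fin N → S) => M.r q.1.1 q.1.2 (emp q.2).1 := by
  have hc : Continuous fun q : (S × A) × (Fin N → S) => (q.1.1, q.1.2, (emp q.2).1) := by
    have := continuous_subtype_val.comp (continuous_emp (X := S) (N := N))
    exact (by fun_prop : Continuous fun q : (S × A) × (Fin N → S) => q.1.1).prodMk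
      ((by fun_prop : Continuous fun q : (S × A) × (Fin N → S) => q.1.2).prodMk
        (this.comp continuous_snd))
  exact UpperSemicontinuous.comp h2 hc

theorem measurable_of_mem_Mhat {v : EmpMeas N S → ℝ} (hv : v ∈ Mhat N S) : Measurable v :=
  hv.2.measurable

/-- The action value as a function of the configuration. -/
noncomputable def configValue (M : Model S A 𝒵) (W : Noise N 𝒵 P) (v : EmpMeas N S → ℝ)
    (k : Fin N → S × A) : ℝ :=
  (N : ℝ)⁻¹ * ∑ i, M.r (k i).1 (k i).2 (stateLaw k).1
    + M.β * ∫ z, v (M.step (stateLaw k) k z) ∂W.law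

variable [IsProbabilityMeasure P]

/-- For fixed noise the next state is continuous in the configuration, so `v` of it is upper
semicontinuous; reverse Fatou carries this through the expectation. -/
theorem upperSemicontinuous_configValue {M : Model S A 𝒵} (W : Noise N 𝒵 P) (h2 : M.A2)
    (h3 : M.A3) {v : EmpMeas N S → ℝ} (hv : v ∈ Mhat N S) :
    UpperSemicontinuous (M.configValue W v) := by
  obtain ⟨C, hC⟩ := hv.1
  have mul_usc : ∀ {c : ℝ} {f : (Fin N → S × A) → ℝ}, 0 < c → UpperSemicontinuous f →
      UpperSemicontinuous fun k => c * f k := by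
    intro c f hc hf k y hy
    have : f k < c⁻¹ * y := by rwa [lt_inv_mul_iff₀ hc]
    filter_upwards [hf k _ this] with k' hk'
    rwa [lt_inv_mul_iff₀ hc] at hk'
  have hN : (0 : ℝ) < N := by exact_mod_cast NeZero.pos N
  refine UpperSemicontinuous.add (mul_usc (inv_pos.mpr hN) (upperSemicontinuous_sum fun i _ => ?_))
    (mul_usc M.β_pos (upperSemicontinuous_integral (C := C) (fun k => ?_) (fun k z => hC _)
      fun z => UpperSemicontinuous.comp hv.2 (continuous_step h3 z)))
  · have hc : Continuous fun k : Fin N → S × A => (k i, fun j => (k j).1) := by fun_prop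
    exact UpperSemicontinuous.comp (upperSemicontinuous_r (N := N) h2) hc
  · exact (measurable_of_mem_Mhat hv).comp (M.measurable_step_right _ k)

variable [StandardBorelSpace A]

theorem enum_mem_configs {M : Model S A 𝒵} {μ : EmpMeas N S} {Q : EmpMeas N (S × A)}
    (hQ : Q ∈ M.Dhat μ) : enum Q ∈ M.configs N := by
  obtain ⟨k, hk, -, rfl⟩ := mem_Dhat_iff.mp hQ
  obtain ⟨σ, hσ⟩ := exists_perm_enum_emp k
  rw [← hσ]
  exact fun i => hk (σ i)

theorem abs_rhat_le {M : Model S A 𝒵} (h0 : M.A0) {R : ℝ} (hR : ∀ x a μ, |M.r x a μ| ≤ R)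
    {μ : EmpMeas N S} {Q : EmpMeas N (S × A)} (hQ : Q ∈ M.Dhat μ) : |M.rhat μ Q| ≤ R := by
  rw [← emp_enum Q]
  exact abs_rhat_emp_le h0 hR μ (enum_mem_configs hQ)

theorem That_eq_step (M : Model S A 𝒵) (W : Noise N 𝒵 P) (μ : EmpMeas N S)
    (Q : EmpMeas N (S × A)) (n : ℕ) (ω : Ω) :
    M.That μ Q (fun i => W.idio n i ω) (W.common n ω) = M.step μ (enum Q) (W.vec n ω) := rfl

theorem actionValue_eq (M : Model S A 𝒵) (W : Noise N 𝒵 P) {v : EmpMeas N S → ℝ}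
    (hv : Measurable v) (μ : EmpMeas N S) (Q : EmpMeas N (S × A)) :
    M.actionValue W v μ Q = M.rhat μ Q + M.β * ∫ z, v (M.step μ (enum Q) z) ∂W.law := by
  rw [← W.integral_vec 0 (F := fun z => v (M.step μ (enum Q) z))
    (hv.comp (M.measurable_step_right μ _))]
  rfl

/-- `enum (emp k)` is `k` in some other order. By `step_perm` the permutation passes to the noise,
whose law absorbs it. -/
theorem actionValue_emp {M : Model S A 𝒵} (W : Noise N 𝒵 P) (h0 : M.A0) {v : EmpMeas N S → ℝ}
    (hv : Measurable v) {k : Fin N → S × A} (hk : k ∈ M.configs N) :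
    M.actionValue W v (stateLaw k) (emp k) = M.configValue W v k := by
  obtain ⟨σ, hσ⟩ := exists_perm_enum_emp k
  rw [configValue, ← rhat_emp h0 _ hk,
    ← W.integral_vec_perm 0 σ.symm (F := fun z => v (M.step (stateLaw k) k z))
      (hv.comp (M.measurable_step_right (stateLaw k) k))]
  unfold actionValue
  simp only [That_eq_step, ← hσ, step_perm]

theorem abs_actionValue_le {M : Model S A 𝒵} (W : Noise N 𝒵 P) (h0 : M.A0) {R C : ℝ}
    (hR : ∀ x a μ, |M.r x a μ| ≤ R) {v : EmpMeas N S → ℝ} (hC : ∀ μ, |v μ| ≤ C)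
    {μ : EmpMeas N S} {Q : EmpMeas N (S × A)} (hQ : Q ∈ M.Dhat μ) :
    |M.actionValue W v μ Q| ≤ R + M.β * C := by
  refine (abs_add_le _ _).trans (add_le_add (abs_rhat_le h0 hR hQ) ?_)
  rw [abs_mul, abs_of_pos M.β_pos]
  refine mul_le_mul_of_nonneg_left ?_ M.β_pos.le
  simpa using norm_integral_le_of_norm_le_const (μ := P) (C := C)
    (f := fun ω => v (M.That μ Q (fun i => W.idio 0 i ω) (W.common 0 ω)))
    (ae_of_all _ fun ω => hC _)

theorem bddAbove_actionValue {M : Model S A 𝒵} (W : Noise N 𝒵 P) (h0 : M.A0)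
    {v : EmpMeas N S → ℝ} (hv : v ∈ Mhat N S) (μ : EmpMeas N S) :
    BddAbove (Set.range fun Q : M.Dhat μ => M.actionValue W v μ Q.1) := by
  obtain ⟨C, hC⟩ := hv.1
  obtain ⟨R, hR⟩ := M.bounded_r
  exact ⟨R + M.β * C, by
    rintro _ ⟨Q, rfl⟩
    exact le_of_abs_le (abs_actionValue_le W h0 hR hC Q.2)⟩

theorem actionValue_le_Uhat {M : Model S A 𝒵} (W : Noise N 𝒵 P) (h0 : M.A0)
    {v : EmpMeas N S → ℝ} (hv : v ∈ Mhat N S) {μ : EmpMeas N S} {Q : EmpMeas N (S × A)}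
    (hQ : Q ∈ M.Dhat μ) : M.actionValue W v μ Q ≤ M.Uhat W v μ :=
  le_ciSup (bddAbove_actionValue W h0 hv μ) ⟨Q, hQ⟩

/-- Every bounded upper semicontinuous function has a maximizer, and the optimal value is
upper semicontinuous. -/
theorem exists_isMaximizer_and_upperSemicontinuous_Uhat {M : Model S A 𝒵} (W : Noise N 𝒵 P)
    (h0 : M.A0) (h2 : M.A2) (h3 : M.A3) {v : EmpMeas N S → ℝ} (hv : v ∈ Mhat N S) :
    (∃ φ : M.DecisionRule N, M.IsMaximizer W v φ) ∧ UpperSemicontinuous (M.Uhat W v) := by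
  have hvm := measurable_of_mem_Mhat hv
  have : CompactSpace (M.configs N) := isCompact_iff_compactSpace.mp (isCompact_configs h0)
  have hp : Continuous fun k : M.configs N => stateLaw k.1 :=
    continuous_stateLaw.comp continuous_subtype_val
  have hps : Function.Surjective fun k : M.configs N => stateLaw k.1 := fun μ => by
    obtain ⟨k, hk, h⟩ := M.exists_configs_stateLaw μ
    exact ⟨⟨k, hk⟩, h⟩
  have hg : UpperSemicontinuous fun k : M.configs N => M.configValue W v k.1 :=
    UpperSemicontinuous.comp (upperSemicontinuous_configValue W h2 h3 hv) continuous_subtype_val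
  -- `s μ` is an optimal configuration over `μ`; `emp (s μ)` is the decision rule sought.
  obtain ⟨s, hs, hmax⟩ := exists_measurable_argmax_fiber hp hps hg
  have hmem : ∀ μ, emp (s μ).1 ∈ M.Dhat μ := fun μ =>
    mem_Dhat_iff.mpr ⟨_, (s μ).2, (hmax μ).1, rfl⟩
  have hval : ∀ μ, M.actionValue W v μ (emp (s μ).1) = M.configValue W v (s μ).1 := fun μ => by
    rw [← actionValue_emp W h0 hvm (s μ).2]
    exact congrArg (fun m => M.actionValue W v m (emp (s μ).1)) (hmax μ).1.symm
  have hU : ∀ μ, M.Uhat W v μ = M.configValue W v (s μ).1 := by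
    intro μ
    refine le_antisymm ?_ ((hval μ).symm.trans_le (actionValue_le_Uhat W h0 hv (hmem μ)))
    have : Nonempty (M.Dhat μ) := ⟨⟨_, hmem μ⟩⟩
    refine ciSup_le fun ⟨Q, hQ⟩ => ?_
    obtain ⟨k, hk, rfl, rfl⟩ := mem_Dhat_iff.mp hQ
    rw [actionValue_emp W h0 hvm hk]
    exact (hmax (stateLaw k)).2 ⟨k, hk⟩ rfl
  refine ⟨⟨⟨fun μ => emp (s μ).1, measurable_emp.comp (measurable_subtype_coe.comp hs), hmem⟩,
    fun μ => (hU μ).trans (hval μ).symm⟩, ?_⟩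
  refine upperSemicontinuous_of_isGreatest_fiber hp hg fun μ => ?_
  rw [hU]
  exact ⟨⟨s μ, (hmax μ).1, rfl⟩, by rintro _ ⟨k, hk, rfl⟩; exact (hmax μ).2 k hk⟩

theorem exists_isMaximizer {M : Model S A 𝒵} (W : Noise N 𝒵 P)
    (h0 : M.A0) (h2 : M.A2) (h3 : M.A3) {v : EmpMeas N S → ℝ} (hv : v ∈ Mhat N S) :
    ∃ φ : M.DecisionRule N, M.IsMaximizer W v φ :=
  (exists_isMaximizer_and_upperSemicontinuous_Uhat W h0 h2 h3 hv).1

theorem Uhat_mem_Mhat {M : Model S A 𝒵} (W : Noise N 𝒵 P)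
    (h0 : M.A0) (h2 : M.A2) (h3 : M.A3) {v : EmpMeas N S → ℝ} (hv : v ∈ Mhat N S) :
    M.Uhat W v ∈ Mhat N S := by
  obtain ⟨⟨φ, hφ⟩, husc⟩ := exists_isMaximizer_and_upperSemicontinuous_Uhat W h0 h2 h3 hv
  obtain ⟨C, hC⟩ := hv.1
  obtain ⟨R, hR⟩ := M.bounded_r
  refine ⟨⟨R + M.β * C, fun μ => ?_⟩, husc⟩
  rw [hφ μ]
  exact abs_actionValue_le W h0 hR hC (φ.2.2 μ)

theorem integrable_comp_step {M : Model S A 𝒵} (W : Noise N 𝒵 P) {v : EmpMeas N S → ℝ}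
    (hv : v ∈ Mhat N S) (μ : EmpMeas N S) (k : Fin N → S × A) :
    Integrable (fun z => v (M.step μ k z)) W.law := by
  obtain ⟨C, hC⟩ := hv.1
  exact Integrable.of_bound ((measurable_of_mem_Mhat hv).comp
    (M.measurable_step_right μ k)).aestronglyMeasurable C (ae_of_all _ fun z => hC _)

/-- The maximizer of `v` is an admissible competitor for `w`; under its action the two values differ
by at most the discounted shift `β c`. -/
theorem Uhat_le_add {M : Model S A 𝒵} (W : Noise N 𝒵 P)
    (h0 : M.A0) (h2 : M.A2) (h3 : M.A3) {v w : EmpMeas N S → ℝ} (hv : v ∈ Mhat N S)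
    (hw : w ∈ Mhat N S) {c : ℝ} (hc : ∀ μ, v μ ≤ w μ + c) (μ : EmpMeas N S) :
    M.Uhat W v μ ≤ M.Uhat W w μ + M.β * c := by
  obtain ⟨φ, hφ⟩ := exists_isMaximizer W h0 h2 h3 hv
  have h := actionValue_le_Uhat W h0 hw (φ.2.2 μ)
  rw [actionValue_eq M W (measurable_of_mem_Mhat hw)] at h
  rw [hφ μ, actionValue_eq M W (measurable_of_mem_Mhat hv)]
  have h' : ∫ z, v (M.step μ (enum (φ.1 μ)) z) ∂W.law
      ≤ ∫ z, w (M.step μ (enum (φ.1 μ)) z) ∂W.law + c := by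
    calc _ ≤ ∫ z, (w (M.step μ (enum (φ.1 μ)) z) + c) ∂W.law :=
          integral_mono (integrable_comp_step W hv _ _)
            ((integrable_comp_step W hw _ _).add (integrable_const c)) fun z => hc _
      _ = _ := by
        rw [integral_add (integrable_comp_step W hw _ _) (integrable_const c)]
        simp
  have := mul_le_mul_of_nonneg_left h' M.β_pos.le
  linarith

/-- The operator `Û` is a contraction. -/
theorem abs_Uhat_sub_le {M : Model S A 𝒵} (W : Noise N 𝒵 P)
    (h0 : M.A0) (h2 : M.A2) (h3 : M.A3) {v w : EmpMeas N S → ℝ} (hv : v ∈ Mhat N S)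
    (hw : w ∈ Mhat N S) {c : ℝ} (hc : ∀ μ, |v μ - w μ| ≤ c) (μ : EmpMeas N S) :
    |M.Uhat W v μ - M.Uhat W w μ| ≤ M.β * c := by
  have h1 := Uhat_le_add W h0 h2 h3 hv hw (c := c) (fun m => by linarith [(abs_le.mp (hc m)).2]) μ
  have h2 := Uhat_le_add W h0 h2 h3 hw hv (c := c) (fun m => by linarith [(abs_le.mp (hc m)).1]) μ
  exact abs_le.mpr ⟨by linarith, by linarith⟩

end Model

end MeanField

namespace MeanField

/-! ### Telescoping of discounted sums -/

section DiscountedSums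

variable {a e : ℕ → ℝ} {β R C : ℝ}

theorem summable_discounted (hβ : 0 < β) (hβ1 : β < 1) (ha : ∀ n, |a n| ≤ R) :
    Summable fun k => β ^ k * a k := by
  refine Summable.of_norm_bounded ((summable_geometric_of_lt_one hβ.le hβ1).mul_right R)
    fun k => ?_
  rw [Real.norm_eq_abs, abs_mul, abs_of_pos (pow_pos hβ k)]
  exact mul_le_mul_of_nonneg_left (ha k) (pow_pos hβ k).le

/-- Telescoping of a discounted inequality of Bellman type. -/
theorem tsum_discounted_le (hβ : 0 < β) (hβ1 : β < 1) (ha : ∀ n, |a n| ≤ R)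
    (he : ∀ n, |e n| ≤ C) (h : ∀ n, a n + β * e (n + 1) ≤ e n) :
    ∑' k, β ^ k * a k ≤ e 0 := by
  have hpart : ∀ n, ∑ k ∈ Finset.range n, β ^ k * a k + β ^ n * e n ≤ e 0 := by
    intro n
    induction n with
    | zero => simp
    | succ n ih =>
      rw [Finset.sum_range_succ, pow_succ]
      have := mul_le_mul_of_nonneg_left (h n) (pow_pos hβ n).le
      linarith
  have hzero : Tendsto (fun n => β ^ n * e n) atTop (𝓝 0) := by
    refine squeeze_zero_norm (a := fun n => β ^ n * C) (fun n => ?_) ?_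
    · rw [Real.norm_eq_abs, abs_mul, abs_of_pos (pow_pos hβ n)]
      exact mul_le_mul_of_nonneg_left (he n) (pow_pos hβ n).le
    · simpa using (tendsto_pow_atTop_nhds_zero_of_lt_one hβ.le hβ1).mul_const C
  have hsum := (summable_discounted hβ hβ1 ha).hasSum.tendsto_sum_nat
  refine le_of_tendsto (by simpa using hsum.add hzero) (Eventually.of_forall hpart)

theorem tsum_discounted_eq (hβ : 0 < β) (hβ1 : β < 1) (ha : ∀ n, |a n| ≤ R)
    (he : ∀ n, |e n| ≤ C) (h : ∀ n, a n + β * e (n + 1) = e n) :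
    ∑' k, β ^ k * a k = e 0 := by
  refine le_antisymm (tsum_discounted_le hβ hβ1 ha he fun n => (h n).le) ?_
  -- The reverse inequality is the same lemma with signs changed.
  have := tsum_discounted_le (a := fun n => -a n) (e := fun n => -e n) hβ hβ1
    (fun n => (abs_neg _).trans_le (ha n)) (fun n => (abs_neg _).trans_le (he n))
    fun n => by linarith [h n]
  simp only [mul_neg, tsum_neg] at this
  linarith

end DiscountedSums

/-! ### State process, verification and value iteration -/

namespace Model

set_option linter.unusedSectionVars false

variable {S A 𝒵 Ω : Type*}
  [TopologicalSpace S] [PolishSpace S] [MeasurableSpace S] [BorelSpace S]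
  [TopologicalSpace A] [TopologicalSpace.MetrizableSpace A] [SecondCountableTopology A]
  [MeasurableSpace A] [BorelSpace A] [StandardBorelSpace A]
  [MeasurableSpace 𝒵] [MeasurableSpace Ω] {P : Measure Ω} {N : ℕ} [NeZero N]

/-- Given a decision rule, the next state is a measurable function of state and noise. -/
theorem measurable_step_rule (M : Model S A 𝒵) (φ : M.DecisionRule N) :
    Measurable fun q : EmpMeas N S × (Option (Fin N) → 𝒵) =>
      M.step q.1 (enum (φ.1 q.1)) q.2 := by
  have h : Measurable fun q : EmpMeas N S × (Option (Fin N) → 𝒵) =>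
      (q.1, enum (φ.1 q.1), q.2) :=
    measurable_fst.prodMk (((measurable_enum.comp φ.2.1).comp measurable_fst).prodMk measurable_snd)
  have h' := M.measurable_step.comp h
  exact h'

/-- The state at time `n` uses only the noises of the first `n` transitions, hence is independent of
`W.vec n`. -/
theorem measurable_state_past (M : Model S A 𝒵) (W : Noise N 𝒵 P) (ψ : ℕ → M.DecisionRule N)
    (μ : EmpMeas N S) (n : ℕ) : Measurable[W.past n] (M.state W ψ μ n) := by
  induction n with
  | zero => exact @measurable_const _ _ _ (W.past 0) μ
  | succ n ih =>
    have h1 : Measurable[W.past (n + 1)] (M.state W ψ μ n) :=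
      ih.mono (W.past_mono n.le_succ) le_rfl
    have h2 := @Measurable.prodMk _ (W.past (n + 1)) _ _ _ _ _ _ h1 (W.measurable_vec_past n)
    have h3 := @Measurable.comp _ _ _ (W.past (n + 1)) _ _ _ _ (M.measurable_step_rule (ψ n)) h2
    exact h3

theorem measurable_state (M : Model S A 𝒵) (W : Noise N 𝒵 P) (ψ : ℕ → M.DecisionRule N)
    (μ : EmpMeas N S) (n : ℕ) : Measurable (M.state W ψ μ n) :=
  (M.measurable_state_past W ψ μ n).mono (W.past_le n) le_rfl

theorem measurable_rhat_rule {M : Model S A 𝒵} (h0 : M.A0) (h2 : M.A2) (φ : M.DecisionRule N) :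
    Measurable fun μ => M.rhat μ (φ.1 μ) := by
  -- Listing atoms by `enum` turns the integral into a finite sum of measurable functions of `μ`.
  have heq : (fun μ => M.rhat μ (φ.1 μ)) = fun μ => (N : ℝ)⁻¹ *
      ∑ i, M.r (enum (φ.1 μ) i).1 (enum (φ.1 μ) i).2 (emp (enum μ)).1 := by
    funext μ
    rw [emp_enum μ, ← rhat_emp h0 μ (enum_mem_configs (φ.2.2 μ)), emp_enum]
  rw [heq]
  refine Measurable.const_mul (Finset.measurable_sum _ fun i _ => ?_) _
  have h : Measurable fun μ : EmpMeas N S => (enum (φ.1 μ) i, enum μ) :=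
    ((measurable_pi_apply i).comp (measurable_enum.comp φ.2.1)).prodMk measurable_enum
  exact (upperSemicontinuous_r (N := N) h2).measurable.comp h

variable [IsProbabilityMeasure P]

theorem abs_integral_le_of_abs_le {f : Ω → ℝ} {C : ℝ} (h : ∀ ω, |f ω| ≤ C) :
    |∫ ω, f ω ∂P| ≤ C := by
  simpa using norm_integral_le_of_norm_le_const (μ := P) (C := C) (f := f) (ae_of_all _ h)

theorem measurable_integral_step_rule (M : Model S A 𝒵) (W : Noise N 𝒵 P) {v : EmpMeas N S → ℝ}
    (hv : Measurable v) (φ : M.DecisionRule N) :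
    Measurable fun μ => ∫ z, v (M.step μ (enum (φ.1 μ)) z) ∂W.law :=
  (hv.comp (M.measurable_step_rule φ)).stronglyMeasurable.integral_prod_right'.measurable

theorem measurable_actionValue_rule {M : Model S A 𝒵} (W : Noise N 𝒵 P) (h0 : M.A0) (h2 : M.A2)
    {v : EmpMeas N S → ℝ} (hv : Measurable v) (φ : M.DecisionRule N) :
    Measurable fun μ => M.actionValue W v μ (φ.1 μ) := by
  simp only [actionValue_eq M W hv]
  exact (measurable_rhat_rule h0 h2 φ).add
    ((M.measurable_integral_step_rule W hv φ).const_mul _)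

/-- The expected action value along the state process. -/
theorem integral_actionValue_state {M : Model S A 𝒵} (W : Noise N 𝒵 P) (h0 : M.A0) (h2 : M.A2)
    {v : EmpMeas N S → ℝ} (hv : v ∈ Mhat N S) (ψ : ℕ → M.DecisionRule N) (μ : EmpMeas N S)
    (n : ℕ) :
    ∫ ω, M.actionValue W v (M.state W ψ μ n ω) ((ψ n).1 (M.state W ψ μ n ω)) ∂P
      = ∫ ω, M.rhat (M.state W ψ μ n ω) ((ψ n).1 (M.state W ψ μ n ω)) ∂P
        + M.β * ∫ ω, v (M.state W ψ μ (n + 1) ω) ∂P := by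
  obtain ⟨C, hC⟩ := hv.1
  obtain ⟨R, hR⟩ := M.bounded_r
  have hvm := measurable_of_mem_Mhat hv
  have hst := M.measurable_state W ψ μ n
  have hnext : ∫ ω, v (M.state W ψ μ (n + 1) ω) ∂P = ∫ ω, ∫ z, v (M.step (M.state W ψ μ n ω)
      (enum ((ψ n).1 (M.state W ψ μ n ω))) z) ∂W.law ∂P :=
    W.integral_past_vec (M.measurable_state_past W ψ μ n)
      (F := fun m z => v (M.step m (enum ((ψ n).1 m)) z))
      (hvm.comp (M.measurable_step_rule (ψ n))) fun m z => hC _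
  rw [hnext, ← integral_const_mul, ← integral_add]
  · simp only [actionValue_eq M W hvm]
  · exact Integrable.of_bound ((measurable_rhat_rule h0 h2 (ψ n)).comp hst).aestronglyMeasurable R
      (ae_of_all _ fun ω => abs_rhat_le h0 hR ((ψ n).2.2 _))
  · exact (Integrable.of_bound
      ((M.measurable_integral_step_rule W hvm (ψ n)).comp hst).aestronglyMeasurable C
      (ae_of_all _ fun ω => abs_integral_le_of_abs_le fun z => hC _)).const_mul _

/-- Verification: a bounded function dominating its action values dominates the value of every
policy. -/
theorem policyValue_le {M : Model S A 𝒵} (W : Noise N 𝒵 P) (h0 : M.A0) (h2 : M.A2)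
    {v : EmpMeas N S → ℝ} (hv : v ∈ Mhat N S)
    (h : ∀ μ, ∀ Q ∈ M.Dhat μ, M.actionValue W v μ Q ≤ v μ)
    (ψ : ℕ → M.DecisionRule N) (μ : EmpMeas N S) : M.policyValue W ψ μ ≤ v μ := by
  obtain ⟨C, hC⟩ := hv.1
  obtain ⟨R, hR⟩ := M.bounded_r
  have hvm := measurable_of_mem_Mhat hv
  -- Here `e n` is the expectation of `v` at time `n`; `e 0 = v μ` because the initial state is
  -- deterministic.
  have key := tsum_discounted_le
    (a := fun n => ∫ ω, M.rhat (M.state W ψ μ n ω) ((ψ n).1 (M.state W ψ μ n ω)) ∂P)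
    (e := fun n => ∫ ω, v (M.state W ψ μ n ω) ∂P) M.β_pos M.β_lt_one
    (fun n => abs_integral_le_of_abs_le fun ω => abs_rhat_le h0 hR ((ψ n).2.2 _))
    (fun n => abs_integral_le_of_abs_le fun ω => hC _) fun n => ?_
  · simpa [policyValue, state] using key
  · rw [← integral_actionValue_state W h0 h2 hv]
    have hst := M.measurable_state W ψ μ n
    refine integral_mono ?_ ?_ fun ω => h _ _ ((ψ n).2.2 _)
    · exact Integrable.of_bound
        ((measurable_actionValue_rule W h0 h2 hvm (ψ n)).comp hst).aestronglyMeasurable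
        (R + M.β * C) (ae_of_all _ fun ω => abs_actionValue_le W h0 hR hC ((ψ n).2.2 _))
    · exact Integrable.of_bound (hvm.comp hst).aestronglyMeasurable C (ae_of_all _ fun ω => hC _)

/-- A decision rule that reproduces `v` as its action value has `v` as its stationary value. -/
theorem policyValue_stationary_eq {M : Model S A 𝒵} (W : Noise N 𝒵 P) (h0 : M.A0) (h2 : M.A2)
    {v : EmpMeas N S → ℝ} (hv : v ∈ Mhat N S) (φ : M.DecisionRule N)
    (h : ∀ μ, M.actionValue W v μ (φ.1 μ) = v μ) (μ : EmpMeas N S) :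
    M.policyValue W (fun _ => φ) μ = v μ := by
  obtain ⟨C, hC⟩ := hv.1
  obtain ⟨R, hR⟩ := M.bounded_r
  have key := tsum_discounted_eq
    (a := fun n => ∫ ω, M.rhat (M.state W (fun _ => φ) μ n ω)
      (φ.1 (M.state W (fun _ => φ) μ n ω)) ∂P)
    (e := fun n => ∫ ω, v (M.state W (fun _ => φ) μ n ω) ∂P) M.β_pos M.β_lt_one
    (fun n => abs_integral_le_of_abs_le fun ω => abs_rhat_le h0 hR (φ.2.2 _))
    (fun n => abs_integral_le_of_abs_le fun ω => hC _) fun n => by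
      rw [← integral_actionValue_state W h0 h2 hv (fun _ => φ)]
      simp only [h]
  simpa [policyValue, state] using key

/-- A fixed point of `Û` in `𝕄̂` is the value function. -/
theorem eq_valueFn_of_Uhat_eq {M : Model S A 𝒵} (W : Noise N 𝒵 P) (h0 : M.A0) (h2 : M.A2)
    (h3 : M.A3) {v : EmpMeas N S → ℝ} (hv : v ∈ Mhat N S) (hfix : M.Uhat W v = v) :
    v = M.valueFn W := by
  have hle : ∀ ψ μ, M.policyValue W ψ μ ≤ v μ := fun ψ μ =>
    policyValue_le W h0 h2 hv
      (fun μ Q hQ => (actionValue_le_Uhat W h0 hv hQ).trans_eq (congrFun hfix μ)) ψ μ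
  obtain ⟨φ, hφ⟩ := exists_isMaximizer W h0 h2 h3 hv
  -- The upper bound `v` is attained by the stationary policy of a maximizer, so `v` is the
  -- supremum.
  have hφv := policyValue_stationary_eq W h0 h2 hv φ fun μ => by rw [← hφ μ, hfix]
  have : Nonempty (ℕ → M.DecisionRule N) := ⟨fun _ => φ⟩
  funext μ
  refine le_antisymm ?_ (ciSup_le fun ψ => hle ψ μ)
  rw [← hφv μ]
  exact le_ciSup (f := fun ψ => M.policyValue W ψ μ)
    ⟨v μ, by rintro _ ⟨ψ, rfl⟩; exact hle ψ μ⟩ (fun _ => φ)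

theorem upperSemicontinuous_of_tendstoUniformly {X : Type*} [TopologicalSpace X]
    {f : ℕ → X → ℝ} {g : X → ℝ} (hf : ∀ n, UpperSemicontinuous (f n))
    (h : TendstoUniformly f g atTop) : UpperSemicontinuous g := by
  intro x c hc
  obtain ⟨n, hn⟩ := (Metric.tendstoUniformly_iff.mp h ((c - g x) / 3)
    (by linarith)).exists
  have hx := abs_lt.mp (hn x)
  filter_upwards [hf n x (c - (c - g x) / 3) (by linarith [hx.1])] with y hy
  linarith [(abs_lt.mp (hn y)).2]

theorem zero_mem_Mhat : (0 : EmpMeas N S → ℝ) ∈ Mhat N S :=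
  ⟨⟨0, by simp⟩, upperSemicontinuous_const⟩

theorem iterate_Uhat_mem_Mhat {M : Model S A 𝒵} (W : Noise N 𝒵 P) (h0 : M.A0) (h2 : M.A2)
    (h3 : M.A3) (n : ℕ) : (M.Uhat W)^[n] 0 ∈ Mhat N S := by
  induction n with
  | zero => exact zero_mem_Mhat
  | succ n ih =>
    rw [Function.iterate_succ_apply']
    exact Uhat_mem_Mhat W h0 h2 h3 ih

/-- Value iteration converges uniformly to a fixed point of `Û`. -/
theorem exists_fixedPoint_Uhat {M : Model S A 𝒵} (W : Noise N 𝒵 P) (h0 : M.A0) (h2 : M.A2)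
    (h3 : M.A3) : ∃ v ∈ Mhat N S, M.Uhat W v = v ∧
      TendstoUniformly (fun n : ℕ => (M.Uhat W)^[n] 0) v atTop := by
  have hmem := iterate_Uhat_mem_Mhat W h0 h2 h3
  obtain ⟨C, hC⟩ := (hmem 1).1
  -- `C` bounds the first iterate, hence its distance from `0`; contraction then gives geometric
  -- decay, uniformly in `μ`.
  have hstep : ∀ n μ, |(M.Uhat W)^[n + 1] 0 μ - (M.Uhat W)^[n] 0 μ| ≤ C * M.β ^ n := by
    intro n
    induction n with
    | zero => simpa using hC
    | succ n ih =>
      intro μ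
      have h := abs_Uhat_sub_le W h0 h2 h3 (hmem (n + 1)) (hmem n) ih μ
      rw [← Function.iterate_succ_apply' (M.Uhat W), ← Function.iterate_succ_apply' (M.Uhat W)] at h
      exact h.trans_eq (by ring)
  have hdist : ∀ μ n, dist ((M.Uhat W)^[n] 0 μ) ((M.Uhat W)^[n + 1] 0 μ) ≤ C * M.β ^ n := by
    intro μ n
    rw [dist_comm]
    exact hstep n μ
  choose v hv using fun μ =>
    cauchySeq_tendsto_of_complete (cauchySeq_of_le_geometric M.β C M.β_lt_one (hdist μ))
  have hrate : ∀ n μ, |(M.Uhat W)^[n] 0 μ - v μ| ≤ C * M.β ^ n / (1 - M.β) := fun n μ =>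
    dist_le_of_le_geometric_of_tendsto M.β C M.β_lt_one (hdist μ) (hv μ) n
  have hzero : Tendsto (fun n => C * M.β ^ n / (1 - M.β)) atTop (𝓝 0) := by
    simpa using ((tendsto_pow_atTop_nhds_zero_of_lt_one M.β_pos.le M.β_lt_one).const_mul
      C).div_const (1 - M.β)
  have hunif : TendstoUniformly (fun n : ℕ => (M.Uhat W)^[n] 0) v atTop := by
    rw [Metric.tendstoUniformly_iff]
    intro ε hε
    filter_upwards [hzero.eventually (gt_mem_nhds hε)] with n hn μ
    rw [dist_comm]
    exact (hrate n μ).trans_lt hn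
  have hvM : v ∈ Mhat N S := by
    refine ⟨⟨C / (1 - M.β), fun μ => ?_⟩,
      upperSemicontinuous_of_tendstoUniformly (fun n => (hmem n).2) hunif⟩
    simpa using hrate 0 μ
  refine ⟨v, hvM, funext fun μ => ?_, hunif⟩
  -- By contraction the shifted iterates converge to `Û v`, but they also converge to `v`.
  have hlim : Tendsto (fun n => (M.Uhat W)^[n + 1] 0 μ) atTop (𝓝 (M.Uhat W v μ)) := by
    rw [tendsto_iff_dist_tendsto_zero]
    refine squeeze_zero (fun _ => dist_nonneg) (fun n => ?_)
      (by simpa using hzero.const_mul M.β : Tendsto (fun n => M.β * (C * M.β ^ n / (1 - M.β)))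
        atTop (𝓝 0))
    rw [Function.iterate_succ_apply']
    exact abs_Uhat_sub_le W h0 h2 h3 (hmem n) hvM (hrate n) μ
  exact tendsto_nhds_unique hlim ((tendsto_add_atTop_iff_nat 1).mpr (hv μ))

end Model

end MeanField

theorem theorem3p4
    {S A 𝒵 Ω : Type*}
    [TopologicalSpace S] [PolishSpace S] [CompactSpace S] [MeasurableSpace S] [BorelSpace S]
    [TopologicalSpace A] [TopologicalSpace.MetrizableSpace A] [SecondCountableTopology A]
    [MeasurableSpace A] [BorelSpace A] [StandardBorelSpace A]
    [MeasurableSpace 𝒵] [StandardBorelSpace 𝒵]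
    [MeasurableSpace Ω] (P : Measure Ω) [IsProbabilityMeasure P]
    (N : ℕ) [NeZero N] (M : MeanField.Model S A 𝒵) (W : MeanField.Noise N 𝒵 P)
    (h0 : M.A0) (h1 : M.A1) (h2 : M.A2) (h3 : M.A3) :
    -- the operator maps bounded upper semicontinuous functions to such functions
    (∀ v ∈ MeanField.Mhat N S, M.Uhat W v ∈ MeanField.Mhat N S) ∧
    -- a) the value function is its unique fixed point
    (M.valueFn W ∈ MeanField.Mhat N S ∧ M.Uhat W (M.valueFn W) = M.valueFn W ∧
      ∀ v ∈ MeanField.Mhat N S, M.Uhat W v = v → v = M.valueFn W) ∧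
    -- b) value iteration converges (uniformly)
    TendstoUniformly (fun n : ℕ => (M.Uhat W)^[n] 0) (M.valueFn W) atTop ∧
    -- c) a maximizer exists, and every maximizer defines an optimal stationary policy
    (∃ φ : M.DecisionRule N, M.IsMaximizer W (M.valueFn W) φ) ∧
    (∀ φ : M.DecisionRule N, M.IsMaximizer W (M.valueFn W) φ →
      ∀ μ, M.policyValue W (fun _ => φ) μ = M.valueFn W μ) := by
  obtain ⟨v, hv, hfix, hlim⟩ := MeanField.Model.exists_fixedPoint_Uhat W h0 h2 h3
  -- The limit of value iteration is identified with `J^N`, which thereby inherits membership in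
  -- `𝕄̂`, the fixed point equation and the convergence.
  obtain rfl := MeanField.Model.eq_valueFn_of_Uhat_eq W h0 h2 h3 hv hfix
  refine ⟨fun _ hw => MeanField.Model.Uhat_mem_Mhat W h0 h2 h3 hw,
    ⟨hv, hfix, fun w hw hwfix => MeanField.Model.eq_valueFn_of_Uhat_eq W h0 h2 h3 hw hwfix⟩,
    hlim, MeanField.Model.exists_isMaximizer W h0 h2 h3 hv, fun φ hφ => ?_⟩
  exact MeanField.Model.policyValue_stationary_eq W h0 h2 hv φ fun μ => by rw [← hφ μ, hfix]
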